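/- **Setting.** Let $X$ be a metric space, $B(x,\rho)=\{y: d(x,y)\le\rho\}$, and let $\Omega=X\times(0,\infty)$ be the set of formal balls, with $(x_2,\rho_2)\le_s(x_1,\rho_1)$ iff $\rho_2+d(x_1,x_2)\le\rho_1$. For $c>0$, $X$ is *$c$-uniformly perfect* if $B(x,\rho)\setminus B(x,c\rho)\ne\emptyset$ for all $x\in X$ and $0<\rho\le1$. A set $S\subset X$ is *Bernstein* if every nonempty closed perfect subset of $X$ meets both $S$ and $X\setminus S$. Let $0<\alpha,\beta<1$ and $S\subset X$. In each of the following games Bob starts by choosing any $\omega_1=(x_1,\rho_1)\in\Omega$; then Alice and Bob alternately choose $\omega_n'=(x_n',\rho_n')\in\Omega$ and $\omega_{n+1}=(x_{n+1},\rho_{n+1})\in\Omega$, $n=1,2,\dots$, subject to: * *Schmidt's $(\alpha,\beta,S)$-game*: $\omega_n'\le_s\omega_n$, $\omega_{n+1}\le_s\omega_n'$, $\rho_n'=\alpha\rho_n$, $\rho_{n+1}=\beta\rho_n'$. * *The $(\alpha,\beta,S)$-strong winning game*: $\omega_n'\le_s\omega_n$, $\omega_{n+1}\le_s\omega_n'$,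 $\rho_n'\ge\alpha\rho_n$, $\rho_{n+1}\ge\beta\rho_n'$. * *The $(\beta,S)$-absolute winning game*: $\rho_n'\le\beta\rho_n$, $\omega_{n+1}\le_s\omega_n$, $\rho_{n+1}\ge\beta\rho_n$, $B(x_{n+1},\rho_{n+1})\cap B(x_n',\rho_n')=\emptyset$. Alice wins an infinite play if $\bigcap_n B(x_n,\rho_n)\cap S\neq\emptyset$, and Bob wins it otherwise; a player who has no legal move loses. A strategy prescribes a player's move as a function of all the preceding moves; it is winning if it always prescribes legal moves and the player wins every play in which he or she follows it. A game is *undetermined* if neither player has a winning strategy. **Theorem 1.4.** Fix $0<\alpha,\beta<1$. 1. If $X$ is a nonempty complete $c$-uniformly perfect metric space with $c>0$, $S\subset X$ is Bernstein and $\alpha,\beta<c/(1+2c)$, then Schmidt's $(\alpha,\beta,S)$-game and the $(\alpha,\beta,S)$-strong winning game are undetermined. 2. If $X\neq\{0\}$ is a Banach space, $S\subset X$ is Bernstein and $1+\alpha\beta>2\max(\alpha,\beta)$, then Schmidt's $(\alpha,\beta,S)$-game and the $(\alpha,\beta,S)$-strong winning game are undetermined. 3. If $X$ is a nonempty complete $c$-uniformly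 perfect metric space with $c>0$, $S\subset X$ is Bernstein and $\beta<(c/5)^2$, then the $(\beta,S)$-absolute winning game is undetermined. 4. If $X\neq\{0\}$ is a Banach space, $S\subset X$ is Bernstein and $\beta<1/3$, then the $(\beta,S)$-absolute winning game is undetermined. -/

import Mathlib

/-! ### Two-player games of perfect information

Bob makes the first move and the players alternate. A position is the list of the moves made so far,
*most recent move first*; so Bob is to move at positions of even length and Alice at positions of
odd length. -/

/-- A game with moves in `E`: the ruleset `moves` gives the set of legal moves at every position, and
`target` is the set of infinite plays that are won by Alice (`ω 0, ω 2, ω 4, …` are Bob's moves,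
`ω 1, ω 3, …` are Alice's). A player who has no legal move when it is his or her turn loses. -/
structure InfGame (E : Type*) where
  moves : List E → Set E
  target : Set (ℕ → E)

namespace InfGame

variable {E : Type*}

/-- The position after the first `n` moves of the infinite play `ω`. -/
def history (ω : ℕ → E) : ℕ → List E
  | 0 => []
  | n + 1 => ω n :: history ω n

/-- A finite play is legal if each of its moves was legal when it was made. -/
def IsLegal (G : InfGame E) : List E → Prop
  | [] => True
  | a :: p => a ∈ G.moves p ∧ G.IsLegal p

/-- All of Alice's moves in the finite play were made according to `σ`. -/
def AliceCompatible (σ : List E → E) : List E → Prop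
  | [] => True
  | a :: p => (Odd p.length → a = σ p) ∧ AliceCompatible σ p

/-- All of Bob's moves in the finite play were made according to `σ`. -/
def BobCompatible (σ : List E → E) : List E → Prop
  | [] => True
  | a :: p => (Even p.length → a = σ p) ∧ BobCompatible σ p

/-- `σ` is a winning strategy for Alice: whenever she is to move in a legal play that she has played
according to `σ`, the move prescribed by `σ` is legal, and every infinite legal play in which she
follows `σ` belongs to the target set. -/
def IsAliceWinning (G : InfGame E) (σ : List E → E) : Prop :=
  (∀ p, G.IsLegal p → AliceCompatible σ p → Odd p.length → σ p ∈ G.moves p) ∧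
  ∀ ω : ℕ → E, (∀ n, G.IsLegal (history ω n)) → (∀ n, AliceCompatible σ (history ω n)) →
    ω ∈ G.target

/-- `σ` is a winning strategy for Bob: whenever he is to move in a legal play that he has played
according to `σ`, the move prescribed by `σ` is legal, and every infinite legal play in which he
follows `σ` lies outside the target set. -/
def IsBobWinning (G : InfGame E) (σ : List E → E) : Prop :=
  (∀ p, G.IsLegal p → BobCompatible σ p → Even p.length → σ p ∈ G.moves p) ∧
  ∀ ω : ℕ → E, (∀ n, G.IsLegal (history ω n)) → (∀ n, BobCompatible σ (history ω n)) →
    ω ∉ G.target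

/-- One of the players has a winning strategy. -/
def IsDetermined (G : InfGame E) : Prop :=
  (∃ σ, G.IsAliceWinning σ) ∨ (∃ σ, G.IsBobWinning σ)

/-- Neither player has a winning strategy. -/
def IsUndetermined (G : InfGame E) : Prop := ¬ G.IsDetermined

end InfGame

/-! ### Formal balls -/

/-- A formal ball `(x, ρ)` in `X`, with `ρ > 0`. -/
structure FormalBall (X : Type*) where
  center : X
  radius : ℝ
  radius_pos : 0 < radius

namespace FormalBall

variable {X : Type*} [MetricSpace X]

/-- The closed ball associated with a formal ball. -/
def ball (b : FormalBall X) : Set X := Metric.closedBall b.center b.radius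

/-- The partial order on formal balls: `b₂.Inside b₁` means `(x₂, ρ₂) ≤ₛ (x₁, ρ₁)`, that is,
`ρ₂ + d(x₁, x₂) ≤ ρ₁`. -/
def Inside (b₂ b₁ : FormalBall X) : Prop :=
  b₂.radius + dist b₁.center b₂.center ≤ b₁.radius

end FormalBall

/-! ### The three games -/

section Games

variable {X : Type*} [MetricSpace X]

/-- The plays won by Alice: the intersection of Bob's balls meets `S`. -/
def ballTarget (S : Set X) : Set (ℕ → FormalBall X) :=
  {ω | ((⋂ n, (ω (2 * n)).ball) ∩ S).Nonempty}

/-- Schmidt's `(α, β, S)`-game. (In the second clause the position `b :: p` has length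
`p.length + 1`, so Alice is to move exactly if `p.length` is even.) -/
def schmidtGame (α β : ℝ) (S : Set X) : InfGame (FormalBall X) where
  moves
    | [] => Set.univ
    | b :: p => {b' | b'.Inside b ∧ b'.radius = (if Even p.length then α else β) * b.radius}
  target := ballTarget S

/-- The `(α, β, S)`-strong winning game. -/
def strongGame (α β : ℝ) (S : Set X) : InfGame (FormalBall X) where
  moves
    | [] => Set.univ
    | b :: p => {b' | b'.Inside b ∧ (if Even p.length then α else β) * b.radius ≤ b'.radius}
  target := ballTarget S

/-- The `(β, S)`-absolute winning game: after Bob's move `b` Alice deletes a ball whose radius is at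
most `β` times that of `b`; after that (the position is then `a :: b :: p` with `p` of even length,
where `a` is the deleted ball) Bob chooses a formal ball inside `b`, of radius at least `β` times
that of `b`, and disjoint from the deleted ball. -/
def absoluteGame (β : ℝ) (S : Set X) : InfGame (FormalBall X) where
  moves
    | [] => Set.univ
    | [b] => {b' | b'.radius ≤ β * b.radius}
    | a :: b :: p =>
      if Even p.length then
        {b' | b'.Inside b ∧ β * b.radius ≤ b'.radius ∧ Disjoint b'.ball a.ball}
      else {b' | b'.radius ≤ β * a.radius}
  target := ballTarget S

end Games

/-! ### Spaces and sets -/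

/-- `X` is `c`-uniformly perfect (used for `c > 0`). -/
def IsUniformlyPerfect (X : Type*) [MetricSpace X] (c : ℝ) : Prop :=
  ∀ (x : X) (ρ : ℝ), 0 < ρ → ρ ≤ 1 →
    (Metric.closedBall x ρ \ Metric.closedBall x (c * ρ)).Nonempty

/-- `S` is a Bernstein set: every nonempty closed perfect subset of `X` meets both `S` and its
complement. (`Perfect` in Mathlib means closed without isolated points, and includes `∅`.) -/
def IsBernstein {X : Type*} [TopologicalSpace X] (S : Set X) : Prop :=
  ∀ C : Set X, Perfect C → C.Nonempty → (C ∩ S).Nonempty ∧ (C ∩ Sᶜ).Nonempty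

/-! Suppose one player has a winning strategy, and let `P` be the set of legal positions compatible
with it that end with a move of Bob. If the opponent can, from every position in `P`, force smaller
balls and also force a ball avoiding any prescribed point `z`, then `P` is branching. Indeed, a
shrinking chain of positions has balls converging to some `z`, by completeness; escaping from `z`
gives a second continuation whose ball is disjoint from those far along the chain. Iterating this
splitting gives a Cantor scheme, hence a nonempty perfect set, each of whose points is the sole
outcome of a play that follows the strategy. A Bernstein set and its complement both meet this set,
so the strategy loses some play (`isUndetermined_of_isBranching`).

It remains to escape from `z`. In the nested games on uniformly perfect spaces one move suffices, by
`IsUniformlyPerfect.exists_dist_lt`. In a Banach space the opponent keeps moving in a fixed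
direction `v` away from `z`; the inequality on `α` and `β` says that a functional norming `v` gains
more than the other player can take back (`IsNestedGame.escape_bob`, `IsNestedGame.escape_alice`).

In the absolute game Alice escapes by deleting a ball around `z`. Bob finds a centre far from both
`z` and the deleted ball by pigeonhole among three points, or, in a Banach space with `β < 1/3`, by
a density argument on the relative position of `z` along a line (`mem_escapePositions`). -/

namespace FormalBall

variable {X : Type*} [MetricSpace X]

theorem Inside.refl (b : FormalBall X) : b.Inside b := by simp [Inside]

theorem Inside.trans {b₁ b₂ b₃ : FormalBall X} (h : b₃.Inside b₂) (h' : b₂.Inside b₁) :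
    b₃.Inside b₁ := by
  unfold Inside at *
  linarith [dist_triangle b₁.center b₂.center b₃.center]

theorem Inside.ball_subset {b₁ b₂ : FormalBall X} (h : b₂.Inside b₁) : b₂.ball ⊆ b₁.ball := by
  refine Metric.closedBall_subset_closedBall' ?_
  rw [dist_comm]
  exact h

theorem Inside.radius_le {b₁ b₂ : FormalBall X} (h : b₂.Inside b₁) : b₂.radius ≤ b₁.radius :=
  le_trans (le_add_of_nonneg_right dist_nonneg) h

theorem center_mem_ball (b : FormalBall X) : b.center ∈ b.ball :=
  Metric.mem_closedBall_self b.radius_pos.le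

theorem disjoint_ball {b₁ b₂ : FormalBall X}
    (h : b₁.radius + b₂.radius < dist b₁.center b₂.center) : Disjoint b₁.ball b₂.ball :=
  Metric.closedBall_disjoint_closedBall h

end FormalBall

/-! ### Positions as initial segments of plays -/

namespace InfGame

variable {E : Type*} {G : InfGame E} {σ : List E → E} {p q : List E}

@[simp]
theorem length_history (ω : ℕ → E) (n : ℕ) : (history ω n).length = n := by
  induction n with
  | zero => rfl
  | succ n ih => simp [history, ih]

theorem IsLegal.of_suffix (h : p <:+ q) (hq : G.IsLegal q) : G.IsLegal p := by
  induction q with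
  | nil => rwa [List.suffix_nil.1 h]
  | cons a q ih =>
    rcases List.suffix_cons_iff.1 h with rfl | h
    · exact hq
    · exact ih h hq.2

theorem AliceCompatible.of_suffix (h : p <:+ q) (hq : AliceCompatible σ q) :
    AliceCompatible σ p := by
  induction q with
  | nil => rwa [List.suffix_nil.1 h]
  | cons a q ih =>
    rcases List.suffix_cons_iff.1 h with rfl | h
    · exact hq
    · exact ih h hq.2

theorem BobCompatible.of_suffix (h : p <:+ q) (hq : BobCompatible σ q) :
    BobCompatible σ p := by
  induction q with
  | nil => rwa [List.suffix_nil.1 h]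
  | cons a q ih =>
    rcases List.suffix_cons_iff.1 h with rfl | h
    · exact hq
    · exact ih h hq.2

/-- A sequence of positions of unbounded length, each of which continues the previous one, is a
sequence of initial segments of an infinite play. -/
theorem exists_play_of_suffix_chain (P : ℕ → List E) (hP : ∀ n, P n <:+ P (n + 1))
    (hlen : ∀ n, n < (P n).length) :
    ∃ ω : ℕ → E, ∀ k, history ω (P k).length = P k := by
  have hmono : ∀ {m n}, m ≤ n → P m <:+ P n := fun {m n} h => by
    induction n, h using Nat.le_induction with
    | base => exact List.suffix_rfl
    | succ n _ ih => exact ih.trans (hP n)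
  -- Positions list the latest move first, so reversing turns suffixes into prefixes; all `P k` long
  -- enough agree on move `n`.
  let ω : ℕ → E := fun n => (P n).reverse[n]'(by simpa using hlen n)
  have hω : ∀ k n (h : n < (P k).reverse.length), ω n = (P k).reverse[n] := fun k n h => by
    rcases le_total n k with hnk | hnk
    · exact (List.reverse_prefix.2 (hmono hnk)).getElem _
    · exact ((List.reverse_prefix.2 (hmono hnk)).getElem h).symm
  refine ⟨ω, fun k => ?_⟩
  have key : ∀ n ≤ (P k).length, (history ω n).reverse = (P k).reverse.take n := fun n => by
    induction n with
    | zero => intro _; rfl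
    | succ n ih =>
      intro hn
      have h' : n < (P k).reverse.length := by simpa using hn
      rw [history, List.reverse_cons, ih (by omega), hω k n h', List.take_append_getElem]
  have := key _ le_rfl
  rwa [← List.length_reverse, List.take_length, List.reverse_inj, List.length_reverse] at this

end InfGame

/-- The range of a continuous injection of the Cantor space is perfect. -/
theorem perfect_range_of_injective {X : Type*} [TopologicalSpace X] [T2Space X]
    {f : (ℕ → Bool) → X} (hf : Continuous f) (hinj : Function.Injective f) :
    Perfect (Set.range f) := by
  refine ⟨(isCompact_range hf).isClosed, ?_⟩
  rintro _ ⟨s, rfl⟩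
  rw [accPt_iff_nhds]
  intro U hU
  -- Flipping a single late coordinate gives points different from `s` that converge to `s`.
  let t : ℕ → ℕ → Bool := fun n => Function.update s n (!s n)
  have ht : Filter.Tendsto t Filter.atTop (nhds s) := by
    rw [tendsto_pi_nhds]
    intro i
    refine tendsto_const_nhds.congr' ?_
    filter_upwards [Filter.eventually_gt_atTop i] with n hn
    simp [t, Function.update_of_ne hn.ne]
  obtain ⟨n, hn⟩ := (((hf.tendsto s).comp ht).eventually hU).exists
  refine ⟨f (t n), ⟨hn, Set.mem_range_self _⟩, fun h => ?_⟩
  have := congrFun (hinj h) n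
  simp [t] at this

/-! ### Branching sets of positions and their perfect sets of outcomes -/

section Outcomes

variable {X : Type*} [MetricSpace X]

/-- `Reach m n`: the position `n.1 :: n.2` continues the position `m.1 :: m.2`, and its last ball is
inside the last ball of the latter. -/
def Reach (m n : FormalBall X × List (FormalBall X)) : Prop :=
  (m.1 :: m.2) <:+ (n.1 :: n.2) ∧ n.1.Inside m.1

theorem Reach.refl (m : FormalBall X × List (FormalBall X)) : Reach m m :=
  ⟨List.suffix_rfl, .refl _⟩

theorem Reach.trans {l m n : FormalBall X × List (FormalBall X)} (h : Reach l m)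
    (h' : Reach m n) : Reach l n :=
  ⟨h.1.trans h'.1, h'.2.trans h.2⟩

theorem Reach.length_lt {m n : FormalBall X × List (FormalBall X)} (h : Reach m n)
    (hr : n.1.radius < m.1.radius) : (m.1 :: m.2).length < (n.1 :: n.2).length := by
  refine lt_of_le_of_ne h.1.length_le fun he => ?_
  have := List.cons.inj (h.1.eq_of_length he)
  rw [this.1] at hr
  exact lt_irrefl _ hr

/-- From every position in `P` one can reach, within `P`, positions with smaller balls, and positions
whose balls avoid a given point. -/
structure IsBranching (P : Set (FormalBall X × List (FormalBall X))) : Prop where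
  shrink : ∃ θ : ℝ, 0 < θ ∧ θ < 1 ∧
    ∀ m ∈ P, ∃ n ∈ P, Reach m n ∧ n.1.radius ≤ θ * m.1.radius
  escape : ∀ m ∈ P, ∀ z : X, ∃ n ∈ P, Reach m n ∧ z ∉ n.1.ball

theorem exists_reach_radius_le {P : Set (FormalBall X × List (FormalBall X))} {θ : ℝ} (hθ₀ : 0 < θ)
    (hθ : θ < 1) (h : ∀ m ∈ P, ∃ n ∈ P, Reach m n ∧ n.1.radius ≤ θ * m.1.radius)
    {m : FormalBall X × List (FormalBall X)} (hm : m ∈ P) {ε : ℝ} (hε : 0 < ε) :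
    ∃ n ∈ P, Reach m n ∧ n.1.radius ≤ ε := by
  have key : ∀ k : ℕ, ∃ n ∈ P, Reach m n ∧ n.1.radius ≤ θ ^ k * m.1.radius := fun k => by
    induction k with
    | zero => exact ⟨m, hm, .refl m, by simp⟩
    | succ k ih =>
      obtain ⟨n, hn, hmn, hr⟩ := ih
      obtain ⟨n', hn', hnn', hr'⟩ := h n hn
      refine ⟨n', hn', hmn.trans hnn', hr'.trans ?_⟩
      rw [pow_succ', mul_assoc]
      gcongr
  obtain ⟨k, hk⟩ := exists_pow_lt_of_lt_one (div_pos hε m.1.radius_pos) hθ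
  obtain ⟨n, hn, hmn, hr⟩ := key k
  exact ⟨n, hn, hmn, hr.trans ((lt_div_iff₀ m.1.radius_pos).1 hk).le⟩

/-- A chain with balls shrinking to a point `z` provides one branch and an escape from `z` the
other: the escaping ball is closed and misses `z`, so it misses all sufficiently small balls
containing `z`. -/
theorem IsBranching.exists_disjoint [CompleteSpace X]
    {P : Set (FormalBall X × List (FormalBall X))} (hP : IsBranching P)
    {m : FormalBall X × List (FormalBall X)} (hm : m ∈ P) :
    ∃ n₀ ∈ P, ∃ n₁ ∈ P, Reach m n₀ ∧ Reach m n₁ ∧ n₀.1.radius ≤ m.1.radius / 2 ∧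
      n₁.1.radius ≤ m.1.radius / 2 ∧ Disjoint n₀.1.ball n₁.1.ball := by
  obtain ⟨θ, hθ₀, hθ, hs⟩ := hP.shrink
  have hstep : ∀ n : P, ∃ n' : P, Reach n.1 n'.1 ∧ n'.1.1.radius ≤ n.1.1.radius / 2 := fun n => by
    obtain ⟨n', hn', h⟩ := exists_reach_radius_le hθ₀ hθ hs n.2 (half_pos n.1.1.radius_pos)
    exact ⟨⟨n', hn'⟩, h⟩
  choose F hF hF' using hstep
  let c : ℕ → P := fun k => F^[k] (F ⟨m, hm⟩)
  have hc : ∀ k, c (k + 1) = F (c k) := fun k => Function.iterate_succ_apply' _ _ _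
  have hreach : ∀ k l, k ≤ l → Reach (c k).1 (c l).1 := fun k l h => by
    induction l, h using Nat.le_induction with
    | base => exact .refl _
    | succ l _ ih => exact ih.trans (hc l ▸ hF _)
  have hrad : ∀ k, (c k).1.1.radius ≤ m.1.radius * (1 / 2) ^ k := fun k => by
    induction k with
    | zero => linarith [show (c 0).1.1.radius ≤ m.1.radius / 2 from hF' ⟨m, hm⟩, m.1.radius_pos]
    | succ k ih =>
      rw [hc, pow_succ]
      linarith [hF' (c k)]
  have hlim : Filter.Tendsto (fun k => m.1.radius * (1 / 2 : ℝ) ^ k) Filter.atTop (nhds 0) := by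
    simpa using (tendsto_pow_atTop_nhds_zero_of_lt_one (r := (1 / 2 : ℝ)) (by norm_num)
      (by norm_num)).const_mul m.1.radius
  have hmem : ∀ k l, k ≤ l → (c l).1.1.center ∈ (c k).1.1.ball := fun k l h =>
    (hreach k l h).2.ball_subset (FormalBall.center_mem_ball _)
  have hcauchy : CauchySeq fun k => (c k).1.1.center := by
    refine cauchySeq_of_le_tendsto_0' (fun k => m.1.radius * (1 / 2 : ℝ) ^ k) (fun k l h => ?_) hlim
    rw [dist_comm]
    exact (Metric.mem_closedBall.1 (hmem k l h)).trans (hrad k)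
  obtain ⟨z, hz⟩ := cauchySeq_tendsto_of_complete hcauchy
  have hzmem : ∀ k, z ∈ (c k).1.1.ball := fun k =>
    Metric.isClosed_closedBall.mem_of_tendsto hz
      (Filter.eventually_atTop.2 ⟨k, fun l h => hmem k l h⟩)
  -- Escaping from `c 0` rather than from `m` makes the radius at most half that of `m` for this
  -- branch too.
  obtain ⟨n₁, hn₁, hr₁, hz₁⟩ := hP.escape (c 0).1 (c 0).2 z
  have hopen : (n₁.1.ball)ᶜ ∈ nhds z :=
    (Metric.isClosed_closedBall (x := n₁.1.center) (ε := n₁.1.radius)).isOpen_compl.mem_nhds hz₁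
  obtain ⟨ε, hε, hsub⟩ := Metric.mem_nhds_iff.1 hopen
  obtain ⟨k, hk⟩ := (hlim.eventually (gt_mem_nhds (half_pos hε))).exists
  have h0 : Reach m (c 0).1 := hF ⟨m, hm⟩
  have h0' : (c 0).1.1.radius ≤ m.1.radius / 2 := hF' ⟨m, hm⟩
  refine ⟨(c k).1, (c k).2, n₁, hn₁, h0.trans (hreach 0 k k.zero_le), h0.trans hr₁,
    (hreach 0 k k.zero_le).2.radius_le.trans h0', hr₁.2.radius_le.trans h0', ?_⟩
  refine Set.disjoint_left.2 fun y hy => hsub ?_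
  have h1 := Metric.mem_closedBall.1 hy
  have h2 := Metric.mem_closedBall'.1 (hzmem k)
  rw [Metric.mem_ball]
  linarith [dist_triangle y (c k).1.1.center z, hrad k]

open CantorScheme in
/-- The points in the balls of the infinite branches of a branching set contain a perfect set. -/
theorem IsBranching.exists_perfect [CompleteSpace X]
    {P : Set (FormalBall X × List (FormalBall X))} (hP : IsBranching P) (h₀ : P.Nonempty) :
    ∃ C : Set X, Perfect C ∧ C.Nonempty ∧ ∀ x ∈ C, ∃ c : ℕ → FormalBall X × List (FormalBall X),
      (∀ k, c k ∈ P) ∧ (∀ k, Reach (c k) (c (k + 1))) ∧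
      (∀ k, (c (k + 1)).1.radius ≤ (c k).1.radius / 2) ∧ ∀ k, x ∈ (c k).1.ball := by
  obtain ⟨m, hm⟩ := h₀
  have hsplit : ∀ n : P, ∃ F : Bool → P, (∀ i, Reach n.1 (F i).1) ∧
      (∀ i, (F i).1.1.radius ≤ n.1.1.radius / 2) ∧
      Disjoint (F false).1.1.ball (F true).1.1.ball := fun n => by
    obtain ⟨n₀, h₀, n₁, h₁, hr₀, hr₁, hs₀, hs₁, hd⟩ := hP.exists_disjoint n.2
    exact ⟨fun i => bif i then ⟨n₁, h₁⟩ else ⟨n₀, h₀⟩, Bool.forall_bool.2 ⟨hr₀, hr₁⟩,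
      Bool.forall_bool.2 ⟨hs₀, hs₁⟩, hd⟩
  choose F hF hFr hFd using hsplit
  let D : List Bool → P := fun l => l.rec ⟨m, hm⟩ fun i _ n => F n i
  have hD : ∀ i l, D (i :: l) = F (D l) i := fun _ _ => rfl
  let A : List Bool → Set X := fun l => (D l).1.1.ball
  have hanti : ClosureAntitone A := by
    refine CantorScheme.Antitone.closureAntitone (fun l i => ?_) fun l => Metric.isClosed_closedBall
    exact (hF (D l) i).2.ball_subset
  have hdisj : CantorScheme.Disjoint A := by
    rintro l (_ | _) (_ | _) h
    · exact absurd rfl h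
    · exact hFd (D l)
    · exact (hFd (D l)).symm
    · exact absurd rfl h
  have hrad : ∀ (s : ℕ → Bool) k, (D (PiNat.res s k)).1.1.radius ≤ m.1.radius * (1 / 2) ^ k :=
    fun s k => by
      induction k with
      | zero => simp [D]
      | succ k ih =>
        rw [PiNat.res_succ, hD, pow_succ]
        linarith [hFr (D (PiNat.res s k)) (s k)]
  have hvan : VanishingDiam A := by
    intro s
    have hlim : Filter.Tendsto (fun k => ENNReal.ofReal (2 * (m.1.radius * (1 / 2 : ℝ) ^ k)))
        Filter.atTop (nhds 0) := by
      rw [← ENNReal.ofReal_zero]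
      refine ENNReal.tendsto_ofReal ?_
      simpa using ((tendsto_pow_atTop_nhds_zero_of_lt_one (r := (1 / 2 : ℝ)) (by norm_num)
        (by norm_num)).const_mul m.1.radius).const_mul 2
    refine tendsto_of_tendsto_of_tendsto_of_le_of_le tendsto_const_nhds hlim (fun _ => zero_le)
      fun k => ?_
    refine Metric.ediam_le fun x hx y hy => ?_
    rw [edist_dist]
    refine ENNReal.ofReal_le_ofReal ?_
    have h1 := Metric.mem_closedBall.1 hx
    have h2 := Metric.mem_closedBall'.1 hy
    linarith [dist_triangle x (D (PiNat.res s k)).1.1.center y, hrad s k]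
  have hdom : (inducedMap A).1 = Set.univ :=
    hanti.map_of_vanishingDiam hvan fun l => ⟨_, FormalBall.center_mem_ball _⟩
  let f : (ℕ → Bool) → X := fun s => (inducedMap A).2 ⟨s, hdom ▸ Set.mem_univ s⟩
  have hf : Continuous f := hvan.map_continuous.comp (by fun_prop)
  have hinj : Function.Injective f := fun s t h => congrArg Subtype.val (hdisj.map_injective h)
  refine ⟨Set.range f, perfect_range_of_injective hf hinj, Set.range_nonempty f, ?_⟩
  rintro _ ⟨s, rfl⟩
  exact ⟨fun k => (D (PiNat.res s k)).1, fun k => (D (PiNat.res s k)).2, fun k => hF _ _,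
    fun k => hFr _ _, fun k => map_mem _ k⟩

/-- A branching set of positions reached after moves of Bob in a game with nested balls has a perfect
set of outcomes. -/
theorem IsBranching.exists_perfect_outcomes [CompleteSpace X] {G : InfGame (FormalBall X)}
    (hG : ∀ b' a b p, Even p.length → G.IsLegal (b' :: a :: b :: p) → b'.Inside b)
    {P : Set (FormalBall X × List (FormalBall X))} (hP : IsBranching P) (h₀ : P.Nonempty)
    (hleg : ∀ m ∈ P, G.IsLegal (m.1 :: m.2)) (heven : ∀ m ∈ P, Even m.2.length) :
    ∃ C : Set X, Perfect C ∧ C.Nonempty ∧ ∀ x ∈ C, ∃ ω : ℕ → FormalBall X,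
      (∀ n, ∃ m ∈ P, InfGame.history ω n <:+ (m.1 :: m.2)) ∧ ⋂ n, (ω (2 * n)).ball = {x} := by
  obtain ⟨C, hC, hne, h⟩ := hP.exists_perfect h₀
  refine ⟨C, hC, hne, fun x hx => ?_⟩
  obtain ⟨c, hcP, hreach, hrad, hxc⟩ := h x hx
  -- The radii strictly decrease along the chain, so every step of it adds at least one move.
  have hlen : ∀ k, k < ((c k).1 :: (c k).2).length := fun k => by
    induction k with
    | zero => simp
    | succ k ih =>
      exact (Nat.succ_le_of_lt ih).trans_lt ((hreach k).length_lt
        (by linarith [hrad k, (c k).1.radius_pos]))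
  obtain ⟨ω, hω⟩ := InfGame.exists_play_of_suffix_chain (fun k => (c k).1 :: (c k).2)
    (fun k => (hreach k).1) hlen
  have hmono : ∀ {m n}, m ≤ n → InfGame.history ω m <:+ InfGame.history ω n := fun {m n} h => by
    induction n, h using Nat.le_induction with
    | base => exact List.suffix_rfl
    | succ n _ ih => exact ih.trans (List.suffix_cons _ _)
  have hsuff : ∀ n, ∃ m ∈ P, InfGame.history ω n <:+ (m.1 :: m.2) := fun n =>
    ⟨c n, hcP n, by
      have := hmono (hlen n).le
      rwa [hω n] at this⟩
  have hlegal : ∀ n, G.IsLegal (InfGame.history ω n) := fun n => by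
    obtain ⟨m, hm, h⟩ := hsuff n
    exact (hleg m hm).of_suffix h
  -- Since `(c k).2` has even length `2 * j`, the last ball of the position is Bob's move number `2
  -- * j`. Bob's balls are nested, so these cofinally many determine the intersection.
  have hhead : ∀ k, ∃ j, k ≤ 2 * j ∧ ω (2 * j) = (c k).1 := fun k => by
    obtain ⟨j, hj⟩ := heven _ (hcP k)
    have h1 := hω k
    simp only [List.length_cons, InfGame.history, List.cons.injEq] at h1
    have h2 := hlen k
    simp only [List.length_cons] at h2
    exact ⟨j, by omega, by rw [two_mul, ← hj]; exact h1.1⟩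
  have hanti : Antitone fun n => (ω (2 * n)).ball := antitone_nat_of_succ_le fun n =>
    (hG _ _ _ (InfGame.history ω (2 * n)) (by simp) (hlegal (2 * n + 3))).ball_subset
  refine ⟨ω, hsuff, Set.Subset.antisymm (fun y hy => ?_) ?_⟩
  · have hr : ∀ k, (c k).1.radius ≤ (c 0).1.radius * (1 / 2) ^ k := fun k => by
      induction k with
      | zero => simp
      | succ k ih =>
        rw [pow_succ]
        linarith [hrad k]
    have hlim : Filter.Tendsto (fun k => 2 * ((c 0).1.radius * (1 / 2 : ℝ) ^ k)) Filter.atTop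
        (nhds 0) := by
      simpa using ((tendsto_pow_atTop_nhds_zero_of_lt_one (r := (1 / 2 : ℝ)) (by norm_num)
        (by norm_num)).const_mul (c 0).1.radius).const_mul 2
    refine dist_le_zero.1 (ge_of_tendsto' hlim fun k => ?_)
    obtain ⟨j, -, hj⟩ := hhead k
    have h1 := Set.mem_iInter.1 hy j
    rw [hj] at h1
    have h1 := Metric.mem_closedBall.1 h1
    have h2 := Metric.mem_closedBall'.1 (hxc k)
    linarith [dist_triangle y (c k).1.center x, hr k]
  · rw [Set.singleton_subset_iff, Set.mem_iInter]
    intro n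
    obtain ⟨j, hj, hj'⟩ := hhead (2 * n)
    exact hanti (by omega : n ≤ j) (show x ∈ (ω (2 * j)).ball from hj' ▸ hxc _)

/-- `P` is a set of positions in which it is Alice's turn; in each of them she has a legal move such
that all the answers of Bob lead to `P`. -/
structure IsAliceClosed (G : InfGame (FormalBall X))
    (P : Set (FormalBall X × List (FormalBall X))) : Prop where
  even : ∀ b p, (b, p) ∈ P → Even p.length
  round : ∀ b p, (b, p) ∈ P → ∃ a ∈ G.moves (b :: p),
    ∀ b' ∈ G.moves (a :: b :: p), (b', a :: b :: p) ∈ P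

/-- `P` is a set of positions in which it is Alice's turn; in each of them Bob can answer every legal
move so as to return to `P`. -/
structure IsBobClosed (G : InfGame (FormalBall X))
    (P : Set (FormalBall X × List (FormalBall X))) : Prop where
  even : ∀ b p, (b, p) ∈ P → Even p.length
  round : ∀ b p, (b, p) ∈ P → ∀ a ∈ G.moves (b :: p),
    ∃ b' ∈ G.moves (a :: b :: p), (b', a :: b :: p) ∈ P

/-! ### From branching positions to undetermined games -/

theorem IsBranching.inter_radius_le {P : Set (FormalBall X × List (FormalBall X))}
    (hP : IsBranching P) (R : ℝ) : IsBranching (P ∩ {m | m.1.radius ≤ R}) := by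
  obtain ⟨⟨θ, hθ₀, hθ, hs⟩, he⟩ := hP
  refine ⟨⟨θ, hθ₀, hθ, fun m hm => ?_⟩, fun m hm z => ?_⟩
  · obtain ⟨n, hn, hr, h⟩ := hs m hm.1
    exact ⟨n, ⟨hn, hr.2.radius_le.trans hm.2⟩, hr, h⟩
  · obtain ⟨n, hn, hr, h⟩ := he m hm.1 z
    exact ⟨n, ⟨hn, hr.2.radius_le.trans hm.2⟩, hr, h⟩

/-- Bob may choose the radius of his first ball, so that it suffices to consider positions with small
balls when he plays against a strategy of Alice. -/
theorem isUndetermined_of_isBranching [CompleteSpace X] [Nonempty X] {G : InfGame (FormalBall X)}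
    {S : Set X} (hS : IsBernstein S) (hT : G.target = ballTarget S) (h₀ : G.moves [] = Set.univ)
    (hG : ∀ b' a b p, Even p.length → G.IsLegal (b' :: a :: b :: p) → b'.Inside b)
    (hA : ∀ P, IsAliceClosed G P → IsBranching (P ∩ {m | m.1.radius ≤ 1}))
    (hB : ∀ P, IsBobClosed G P → IsBranching P) :
    G.IsUndetermined := by
  rintro (⟨σ, hσ, hwin⟩ | ⟨σ, hσ, hwin⟩)
  · let P : Set (FormalBall X × List (FormalBall X)) :=
      {m | (G.IsLegal (m.1 :: m.2) ∧ InfGame.AliceCompatible σ (m.1 :: m.2)) ∧ Even m.2.length}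
    have hP : IsAliceClosed G P := by
      refine ⟨fun b p h => h.2, fun b p h => ?_⟩
      have hodd : Odd (b :: p).length := by
        rw [List.length_cons]
        exact h.2.add_one
      have hmove := hσ _ h.1.1 h.1.2 hodd
      refine ⟨_, hmove, fun b' hb' => ⟨⟨⟨hb', hmove, h.1.1⟩, ?_, fun _ => rfl, h.1.2⟩, ?_⟩⟩
      · intro h'
        exact absurd h' (by simpa [Nat.even_add_one] using h.2)
      · exact hodd.add_one
    obtain ⟨x⟩ := ‹Nonempty X›
    have hne : (P ∩ {m | m.1.radius ≤ 1}).Nonempty := ⟨(⟨x, 1, one_pos⟩, []),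
      ⟨⟨⟨h₀ ▸ Set.mem_univ _, trivial⟩, fun h => absurd h (by simp), trivial⟩, by simp⟩,
      le_refl (1 : ℝ)⟩
    obtain ⟨C, hC, hCne, hout⟩ := (hA P hP).exists_perfect_outcomes hG hne (fun m h => h.1.1.1)
      fun m h => h.1.2
    obtain ⟨y, hyC, hyS⟩ := (hS C hC hCne).2
    obtain ⟨ω, hω, hy⟩ := hout y hyC
    have := hwin ω (fun n => let ⟨m, hm, h⟩ := hω n; hm.1.1.1.of_suffix h)
      fun n => let ⟨m, hm, h⟩ := hω n; hm.1.1.2.of_suffix h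
    rw [hT] at this
    obtain ⟨w, hw, hwS⟩ := this
    rw [hy] at hw
    exact hyS (Set.mem_singleton_iff.1 hw ▸ hwS)
  · let P : Set (FormalBall X × List (FormalBall X)) :=
      {m | (G.IsLegal (m.1 :: m.2) ∧ InfGame.BobCompatible σ (m.1 :: m.2)) ∧ Even m.2.length}
    have hP : IsBobClosed G P := by
      refine ⟨fun b p h => h.2, fun b p h a ha => ?_⟩
      have hodd : Odd (b :: p).length := by
        rw [List.length_cons]
        exact h.2.add_one
      have heven : Even (a :: b :: p).length := by
        rw [List.length_cons]
        exact hodd.add_one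
      have hleg : G.IsLegal (a :: b :: p) := ⟨ha, h.1.1⟩
      have hcomp : InfGame.BobCompatible σ (a :: b :: p) :=
        ⟨fun h' => absurd h' (Nat.not_even_iff_odd.2 hodd), h.1.2⟩
      have hmove := hσ _ hleg hcomp heven
      exact ⟨_, hmove, ⟨⟨hmove, hleg⟩, fun _ => rfl, hcomp⟩, heven⟩
    have hne : P.Nonempty := ⟨(σ [], []),
      ⟨⟨h₀ ▸ Set.mem_univ _, trivial⟩, fun _ => rfl, trivial⟩, by simp⟩
    obtain ⟨C, hC, hCne, hout⟩ := (hB P hP).exists_perfect_outcomes hG hne (fun m h => h.1.1)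
      fun m h => h.2
    obtain ⟨y, hyC, hyS⟩ := (hS C hC hCne).1
    obtain ⟨ω, hω, hy⟩ := hout y hyC
    refine hwin ω (fun n => let ⟨m, hm, h⟩ := hω n; hm.1.1.of_suffix h)
      (fun n => let ⟨m, hm, h⟩ := hω n; hm.1.2.of_suffix h) ?_
    rw [hT]
    exact ⟨y, hy ▸ rfl, hyS⟩

end Outcomes

theorem reach_round {X : Type*} [MetricSpace X] {b' b : FormalBall X} (a : FormalBall X)
    (p : List (FormalBall X)) (h : b'.Inside b) : Reach (b, p) (b', a :: b :: p) :=
  ⟨⟨[b', a], rfl⟩, h⟩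

/-! ### Games in which both players choose nested balls -/

/-- In the game `G`, a legal move is a ball inside the previous one, with at least `α` (for Alice) or
`β` (for Bob) times its radius, and these lower bounds are attained. -/
structure IsNestedGame {X : Type*} [MetricSpace X] (α β : ℝ) (G : InfGame (FormalBall X)) :
    Prop where
  nil : G.moves [] = Set.univ
  alice_move : ∀ {a b p}, Even p.length → a ∈ G.moves (b :: p) →
    a.Inside b ∧ α * b.radius ≤ a.radius
  alice_mem : ∀ {a b p}, Even p.length → a.Inside b → a.radius = α * b.radius →
    a ∈ G.moves (b :: p)
  bob_move : ∀ {a b p}, ¬ Even p.length → a ∈ G.moves (b :: p) →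
    a.Inside b ∧ β * b.radius ≤ a.radius
  bob_mem : ∀ {a b p}, ¬ Even p.length → a.Inside b → a.radius = β * b.radius →
    a ∈ G.moves (b :: p)

section Nested

variable {X : Type*} [MetricSpace X] {α β : ℝ} {S : Set X}

theorem isNestedGame_schmidtGame : IsNestedGame α β (schmidtGame α β S) where
  nil := rfl
  alice_move h h' := ⟨h'.1, by simpa [h] using h'.2.ge⟩
  alice_mem h h₁ h₂ := ⟨h₁, by simpa [h] using h₂⟩
  bob_move h h' := ⟨h'.1, by simpa [h] using h'.2.ge⟩
  bob_mem h h₁ h₂ := ⟨h₁, by simpa [h] using h₂⟩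

theorem isNestedGame_strongGame : IsNestedGame α β (strongGame α β S) where
  nil := rfl
  alice_move h h' := ⟨h'.1, by simpa [h] using h'.2⟩
  alice_mem h h₁ h₂ := ⟨h₁, by simpa [h] using h₂.ge⟩
  bob_move h h' := ⟨h'.1, by simpa [h] using h'.2⟩
  bob_mem h h₁ h₂ := ⟨h₁, by simpa [h] using h₂.ge⟩

variable {G : InfGame (FormalBall X)} {P : Set (FormalBall X × List (FormalBall X))}

theorem IsNestedGame.inside (hG : IsNestedGame α β G) (b' a b p) (hp : Even p.length)
    (h : G.IsLegal (b' :: a :: b :: p)) : b'.Inside b :=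
  (hG.bob_move (by simpa [Nat.even_add_one] using hp) h.1).1.trans (hG.alice_move hp h.2.1).1

/-- Bob's options against a strategy of Alice. -/
theorem IsNestedGame.exists_alice_ball (hG : IsNestedGame α β G) (hβ₀ : 0 < β)
    (hP : IsAliceClosed G P) {b : FormalBall X} {p : List (FormalBall X)} (h : (b, p) ∈ P) :
    ∃ a : FormalBall X, a.Inside b ∧ α * b.radius ≤ a.radius ∧
      ∀ y, dist a.center y ≤ (1 - β) * a.radius →
        ∃ n ∈ P, Reach (b, p) n ∧ n.1.center = y ∧ n.1.radius = β * a.radius := by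
  obtain ⟨a, ha, hr⟩ := hP.round b p h
  have hp := hP.even b p h
  obtain ⟨hin, hrad⟩ := hG.alice_move hp ha
  refine ⟨a, hin, hrad, fun y hy => ?_⟩
  let b' : FormalBall X := ⟨y, β * a.radius, mul_pos hβ₀ a.radius_pos⟩
  have hb' : b'.Inside a := by
    change β * a.radius + dist a.center y ≤ a.radius
    linarith
  exact ⟨(b', a :: b :: p), hr b' (hG.bob_mem (by simpa [Nat.even_add_one] using hp) hb' rfl),
    reach_round a p (hb'.trans hin), rfl, rfl⟩

/-- Alice's options against a strategy of Bob. -/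
theorem IsNestedGame.exists_bob_ball (hG : IsNestedGame α β G) (hα₀ : 0 < α)
    (hP : IsBobClosed G P) {b : FormalBall X} {p : List (FormalBall X)} (h : (b, p) ∈ P) (y : X)
    (hy : dist b.center y ≤ (1 - α) * b.radius) :
    ∃ n ∈ P, Reach (b, p) n ∧ n.1.radius + dist y n.1.center ≤ α * b.radius ∧
      β * (α * b.radius) ≤ n.1.radius := by
  let a : FormalBall X := ⟨y, α * b.radius, mul_pos hα₀ b.radius_pos⟩
  have ha : a.Inside b := by
    change α * b.radius + dist b.center y ≤ b.radius
    linarith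
  have hp := hP.even b p h
  obtain ⟨b', hb', hr⟩ := hP.round b p h a (hG.alice_mem hp ha rfl)
  obtain ⟨hin, hrad⟩ := hG.bob_move (by simpa [Nat.even_add_one] using hp) hb'
  exact ⟨(b', a :: b :: p), hr, reach_round a p (hin.trans ha), hin, hrad⟩

theorem IsNestedGame.shrink_alice (hG : IsNestedGame α β G) (hβ₀ : 0 < β) (hβ₁ : β < 1)
    (hP : IsAliceClosed G P) :
    ∀ m ∈ P, ∃ n ∈ P, Reach m n ∧ n.1.radius ≤ β * m.1.radius := by
  rintro ⟨b, p⟩ hm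
  obtain ⟨a, ha, -, h⟩ := hG.exists_alice_ball hβ₀ hP hm
  obtain ⟨n, hn, hr, -, hn'⟩ := h a.center (by
    rw [dist_self]
    exact mul_nonneg (by linarith) a.radius_pos.le)
  refine ⟨n, hn, hr, ?_⟩
  rw [hn']
  exact mul_le_mul_of_nonneg_left ha.radius_le hβ₀.le

theorem IsNestedGame.shrink_bob (hG : IsNestedGame α β G) (hα₀ : 0 < α) (hα₁ : α < 1)
    (hP : IsBobClosed G P) :
    ∀ m ∈ P, ∃ n ∈ P, Reach m n ∧ n.1.radius ≤ α * m.1.radius := by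
  rintro ⟨b, p⟩ hm
  obtain ⟨n, hn, hr, hn', -⟩ := hG.exists_bob_ball hα₀ hP hm b.center (by
    rw [dist_self]
    exact mul_nonneg (by linarith) b.radius_pos.le)
  exact ⟨n, hn, hr, by linarith [dist_nonneg (x := b.center) (y := n.1.center)]⟩

/-- If `x` itself is too close to `z`, take `y` in an annulus around `z` of outer radius `(1 - 2 *
γ) * r`. The bound on `γ` is equivalent to `γ < c * (1 - 2 * γ)`, which makes the inner radius
larger than `γ * r`. -/
theorem IsUniformlyPerfect.exists_dist_lt {c γ r : ℝ} (hX : IsUniformlyPerfect X c) (hc : 0 < c)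
    (hγ : γ < c / (1 + 2 * c)) (hr₀ : 0 < r) (hr₁ : r ≤ 1) (hγ₀ : 0 < γ) (x z : X) :
    ∃ y, dist x y ≤ (1 - γ) * r ∧ γ * r < dist y z := by
  have h := (lt_div_iff₀ (by linarith)).1 hγ
  have h1 : γ < 1 / 2 := by nlinarith
  rcases lt_or_ge (γ * r) (dist x z) with hz | hz
  · exact ⟨x, by rw [dist_self]; exact mul_nonneg (by linarith) hr₀.le, hz⟩
  · obtain ⟨y, hy, hy'⟩ := hX z ((1 - 2 * γ) * r) (mul_pos (by linarith) hr₀) (by nlinarith)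
    rw [Metric.mem_closedBall'] at hy
    rw [Metric.mem_closedBall, not_le] at hy'
    exact ⟨y, by linarith [dist_triangle x z y], by nlinarith⟩

theorem IsNestedGame.isUndetermined_of_isUniformlyPerfect [CompleteSpace X] [Nonempty X] {c : ℝ}
    (hG : IsNestedGame α β G) (hT : G.target = ballTarget S) (hα₀ : 0 < α) (hα₁ : α < 1)
    (hβ₀ : 0 < β) (hβ₁ : β < 1) (hc : 0 < c) (hX : IsUniformlyPerfect X c) (hS : IsBernstein S)
    (hα : α < c / (1 + 2 * c)) (hβ : β < c / (1 + 2 * c)) : G.IsUndetermined := by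
  refine isUndetermined_of_isBranching hS hT hG.nil hG.inside
    (fun P hP => .inter_radius_le ⟨⟨β, hβ₀, hβ₁, hG.shrink_alice hβ₀ hβ₁ hP⟩, fun m hm z => ?_⟩ 1)
    (fun P hP => ⟨⟨α, hα₀, hα₁, hG.shrink_bob hα₀ hα₁ hP⟩, fun m hm z => ?_⟩)
  -- Uniform perfectness only concerns radii at most `1`, so the balls are shrunk first.
  · obtain ⟨⟨b, p⟩, hb, hr, h1⟩ :=
      exists_reach_radius_le hβ₀ hβ₁ (hG.shrink_alice hβ₀ hβ₁ hP) hm one_pos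
    obtain ⟨a, ha, -, h⟩ := hG.exists_alice_ball hβ₀ hP hb
    obtain ⟨y, hy, hy'⟩ := hX.exists_dist_lt hc hβ a.radius_pos (ha.radius_le.trans h1) hβ₀
      a.center z
    obtain ⟨n, hn, hr', hn₁, hn₂⟩ := h y hy
    refine ⟨n, hn, hr.trans hr', fun hz => ?_⟩
    have hz := Metric.mem_closedBall'.1 hz
    rw [hn₁, hn₂] at hz
    linarith
  · obtain ⟨⟨b, p⟩, hb, hr, h1⟩ :=
      exists_reach_radius_le hα₀ hα₁ (hG.shrink_bob hα₀ hα₁ hP) hm one_pos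
    obtain ⟨y, hy, hy'⟩ := hX.exists_dist_lt hc hα b.radius_pos h1 hα₀ b.center z
    obtain ⟨n, hn, hr', hn', -⟩ := hG.exists_bob_ball hα₀ hP hb y hy
    refine ⟨n, hn, hr.trans hr', fun hz => ?_⟩
    -- Alice's ball of radius `α * b.radius` around `y` already misses `z`, and Bob's reply lies
    -- inside it.
    have hz := Metric.mem_closedBall'.1 hz
    linarith [dist_triangle y n.1.center z]

end Nested

/-- A unit vector together with a functional of norm one that attains its norm there. -/
structure IsNormingPair {X : Type*} [NormedAddCommGroup X] [NormedSpace ℝ X] (f : X →L[ℝ] ℝ)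
    (v : X) : Prop where
  norm_eq : ‖v‖ = 1
  apply_eq : f v = 1
  abs_le : ∀ x, |f x| ≤ ‖x‖

/-! ### Nested games in Banach spaces: drifting along a norming direction -/

section Banach

variable {X : Type*} [NormedAddCommGroup X] [NormedSpace ℝ X] {f : X →L[ℝ] ℝ} {v : X}

theorem IsNormingPair.neg (h : IsNormingPair f v) : IsNormingPair (-f) (-v) :=
  ⟨by simp [h.norm_eq], by simp [h.apply_eq], fun x => by simpa using h.abs_le x⟩

theorem exists_isNormingPair [Nontrivial X] : ∃ (f : X →L[ℝ] ℝ) (v : X), IsNormingPair f v := by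
  obtain ⟨v, hv⟩ := exists_norm_eq X zero_le_one
  obtain ⟨f, hf, hfv⟩ := exists_dual_vector ℝ v (by rw [hv]; exact one_ne_zero)
  refine ⟨f, v, hv, by simpa [hv] using hfv, fun x => ?_⟩
  simpa [hf] using f.le_opNorm x

theorem exists_isNormingPair_nonneg [Nontrivial X] (u : X) :
    ∃ (f : X →L[ℝ] ℝ) (v : X), IsNormingPair f v ∧ 0 ≤ f u := by
  obtain ⟨f, v, h⟩ := exists_isNormingPair (X := X)
  rcases le_total 0 (f u) with hu | hu
  · exact ⟨f, v, h, hu⟩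
  · exact ⟨-f, -v, h.neg, by simpa using hu⟩

theorem IsNormingPair.abs_sub_le (h : IsNormingPair f v) (x y : X) : |f x - f y| ≤ dist x y := by
  rw [← map_sub, dist_eq_norm]
  exact h.abs_le _

theorem IsNormingPair.dist_add_smul (h : IsNormingPair f v) (x : X) (s : ℝ) :
    dist x (x + s • v) = |s| := by
  rw [dist_self_add_right, norm_smul, h.norm_eq, mul_one, Real.norm_eq_abs]

theorem IsNormingPair.apply_add_smul (h : IsNormingPair f v) (x : X) (s : ℝ) :
    f (x + s • v) = f x + s := by
  simp [h.apply_eq]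

variable {α β : ℝ} {S : Set X} {G : InfGame (FormalBall X)}
  {P : Set (FormalBall X × List (FormalBall X))}

/-- From a ball of radius `r`, Alice moves by `(1 - α) * r` along `v`, and Bob's reply retreats by
at most `α * r - α * β * r`. The net gain `(1 - 2 * α + α * β) * r` of `f` is positive; the first
gain is never lost, while the radii tend to `0`. -/
theorem IsNestedGame.escape_bob [Nontrivial X] (hG : IsNestedGame α β G) (hα₀ : 0 < α)
    (hα₁ : α < 1) (h : 2 * α < 1 + α * β) (hP : IsBobClosed G P)
    {m : FormalBall X × List (FormalBall X)} (hm : m ∈ P) (z : X) :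
    ∃ n ∈ P, Reach m n ∧ z ∉ n.1.ball := by
  obtain ⟨f, v, hf, hz⟩ := exists_isNormingPair_nonneg (m.1.center - z)
  rw [map_sub] at hz
  have hstep : ∀ m ∈ P, ∃ n ∈ P, Reach m n ∧ n.1.radius ≤ α * m.1.radius ∧
      f m.1.center + (1 - 2 * α + α * β) * m.1.radius ≤ f n.1.center := by
    rintro ⟨b, p⟩ hb
    have h0 : 0 ≤ (1 - α) * b.radius := mul_nonneg (by linarith) b.radius_pos.le
    obtain ⟨n, hn, hr, h1, h2⟩ := hG.exists_bob_ball hα₀ hP hb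
      (b.center + ((1 - α) * b.radius) • v) (by rw [hf.dist_add_smul, abs_of_nonneg h0])
    have h3 := (abs_le.1 (hf.abs_sub_le (b.center + ((1 - α) * b.radius) • v) n.1.center)).2
    rw [hf.apply_add_smul] at h3
    refine ⟨n, hn, hr, ?_, ?_⟩
    · linarith [dist_nonneg (x := b.center + ((1 - α) * b.radius) • v) (y := n.1.center)]
    · change f b.center + (1 - 2 * α + α * β) * b.radius ≤ _
      linarith
  have hδ : 0 < (1 - 2 * α + α * β) * m.1.radius := mul_pos (by linarith) m.1.radius_pos
  obtain ⟨m', hm', hmm', -, hfm'⟩ := hstep m hm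
  let Q : Set (FormalBall X × List (FormalBall X)) :=
    P ∩ {n | f z + (1 - 2 * α + α * β) * m.1.radius ≤ f n.1.center}
  have hQ : ∀ m ∈ Q, ∃ n ∈ Q, Reach m n ∧ n.1.radius ≤ α * m.1.radius := by
    rintro l ⟨hl, hl'⟩
    obtain ⟨n, hn, hr, h1, h2⟩ := hstep l hl
    refine ⟨n, ⟨hn, le_trans hl' (le_trans ?_ h2)⟩, hr, h1⟩
    exact le_add_of_nonneg_right (mul_nonneg (by linarith) l.1.radius_pos.le)
  obtain ⟨n, hn, hr, hn'⟩ := exists_reach_radius_le hα₀ hα₁ hQ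
    (m := m') ⟨hm', by
    change f z + (1 - 2 * α + α * β) * m.1.radius ≤ f m'.1.center
    linarith⟩ (half_pos hδ)
  refine ⟨n, hn.1, hmm'.trans hr, fun hzn => ?_⟩
  have h1 := Metric.mem_closedBall'.1 hzn
  have h2 := (abs_le.1 (hf.abs_sub_le n.1.center z)).2
  have h3 : f z + (1 - 2 * α + α * β) * m.1.radius ≤ f n.1.center := hn.2
  linarith

/-- The quantity `f center - (1 - α) * radius` bounds from below the value of `f` at the centre of
Alice's next ball. When Bob goes as far as possible along `v` in that ball, of radius `r`, it
exceeds this value by `(1 - 2 * β + α * β) * r`. So it never decreases, and its first gain over `f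
z` eventually exceeds the radii. -/
theorem IsNestedGame.escape_alice [Nontrivial X] (hG : IsNestedGame α β G) (hα₀ : 0 < α)
    (hα₁ : α < 1) (hβ₀ : 0 < β) (hβ₁ : β < 1) (h : 2 * β < 1 + α * β) (hP : IsAliceClosed G P)
    {m : FormalBall X × List (FormalBall X)} (hm : m ∈ P) (z : X) :
    ∃ n ∈ P, Reach m n ∧ z ∉ n.1.ball := by
  obtain ⟨b, p⟩ := m
  obtain ⟨a, -, -, hmove⟩ := hG.exists_alice_ball hβ₀ hP hm
  obtain ⟨f, v, hf, hz⟩ := exists_isNormingPair_nonneg (a.center - z)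
  rw [map_sub] at hz
  have hdist : ∀ a : FormalBall X,
      dist a.center (a.center + ((1 - β) * a.radius) • v) ≤ (1 - β) * a.radius := fun a => by
    rw [hf.dist_add_smul, abs_of_nonneg (mul_nonneg (by linarith) a.radius_pos.le)]
  obtain ⟨m', hm', hmm', hc, hr⟩ := hmove _ (hdist a)
  have hδ : 0 < (1 - 2 * β + α * β) * a.radius := mul_pos (by linarith) a.radius_pos
  let Q : Set (FormalBall X × List (FormalBall X)) :=
    P ∩ {n | f z + (1 - 2 * β + α * β) * a.radius ≤ f n.1.center - (1 - α) * n.1.radius}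
  have hQ : ∀ m ∈ Q, ∃ n ∈ Q, Reach m n ∧ n.1.radius ≤ β * m.1.radius := by
    rintro ⟨b, p⟩ ⟨hb, hb'⟩
    change _ ≤ f b.center - (1 - α) * b.radius at hb'
    obtain ⟨a', ha', hrad, hmove⟩ := hG.exists_alice_ball hβ₀ hP hb
    obtain ⟨n, hn, hbn, hc, hr⟩ := hmove _ (hdist a')
    refine ⟨n, ⟨hn, le_trans hb' ?_⟩, hbn, ?_⟩
    · rw [hc, hr, hf.apply_add_smul]
      have h1 := (abs_le.1 (hf.abs_sub_le b.center a'.center)).2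
      have h2 : a'.radius + dist b.center a'.center ≤ b.radius := ha'
      have h3 := mul_le_mul_of_nonneg_left hrad (by linarith : 0 ≤ 1 - 2 * β + α * β)
      have h4 := mul_nonneg (mul_nonneg hα₀.le b.radius_pos.le)
        (by linarith : 0 ≤ 1 - 2 * β + α * β)
      linarith
    · rw [hr]
      exact mul_le_mul_of_nonneg_left ha'.radius_le hβ₀.le
  obtain ⟨n, hn, hr', hn'⟩ := exists_reach_radius_le hβ₀ hβ₁ hQ (m := m') ⟨hm', by
    change f z + (1 - 2 * β + α * β) * a.radius ≤ f m'.1.center - (1 - α) * m'.1.radius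
    rw [hc, hr, hf.apply_add_smul]
    linarith⟩ (half_pos hδ)
  refine ⟨n, hn.1, hmm'.trans hr', fun hzn => ?_⟩
  have h1 := Metric.mem_closedBall'.1 hzn
  have h2 := (abs_le.1 (hf.abs_sub_le n.1.center z)).2
  have h3 : f z + (1 - 2 * β + α * β) * a.radius ≤ f n.1.center - (1 - α) * n.1.radius := hn.2
  have h4 := mul_nonneg (sub_nonneg.2 hα₁.le) n.1.radius_pos.le
  linarith

theorem IsNestedGame.isUndetermined_of_banach [CompleteSpace X] [Nontrivial X]
    (hG : IsNestedGame α β G) (hT : G.target = ballTarget S) (hα₀ : 0 < α) (hα₁ : α < 1)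
    (hβ₀ : 0 < β) (hβ₁ : β < 1) (hS : IsBernstein S) (h : 2 * max α β < 1 + α * β) :
    G.IsUndetermined :=
  isUndetermined_of_isBranching hS hT hG.nil hG.inside
    (fun _ hP => .inter_radius_le ⟨⟨β, hβ₀, hβ₁, hG.shrink_alice hβ₀ hβ₁ hP⟩, fun _ hm =>
      hG.escape_alice hα₀ hα₁ hβ₀ hβ₁ (by linarith [le_max_right α β]) hP hm⟩ 1)
    (fun _ hP => ⟨⟨α, hα₀, hα₁, hG.shrink_bob hα₀ hα₁ hP⟩, fun _ hm =>
      hG.escape_bob hα₀ hα₁ (by linarith [le_max_left α β]) hP hm⟩)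

end Banach

/-! ### The absolute winning game -/

section Absolute

variable {X : Type*} [MetricSpace X] {β : ℝ} {S : Set X}
  {P : Set (FormalBall X × List (FormalBall X))}

theorem mem_moves_absoluteGame {a b : FormalBall X} {p : List (FormalBall X)}
    (hp : Even p.length) : a ∈ (absoluteGame β S).moves (b :: p) ↔ a.radius ≤ β * b.radius := by
  match p, hp with
  | [], _ => rfl
  | [_], hp => simp at hp
  | c :: d :: p, hp =>
    have : ¬ Even (d :: p).length := by
      rw [List.length_cons] at hp
      exact fun h => (Nat.even_add_one.1 hp) h
    simp only [absoluteGame, if_neg this]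
    rfl

theorem mem_moves_absoluteGame_bob {b' a b : FormalBall X} {p : List (FormalBall X)}
    (hp : Even p.length) : b' ∈ (absoluteGame β S).moves (a :: b :: p) ↔
      b'.Inside b ∧ β * b.radius ≤ b'.radius ∧ Disjoint b'.ball a.ball := by
  simp only [absoluteGame, if_pos hp]
  rfl

theorem absoluteGame_inside (b' a b : FormalBall X) (p : List (FormalBall X)) (hp : Even p.length)
    (h : (absoluteGame β S).IsLegal (b' :: a :: b :: p)) : b'.Inside b :=
  ((mem_moves_absoluteGame_bob hp).1 h.1).1

/-- Bob's options against a strategy of Alice. -/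
theorem IsAliceClosed.exists_deleted_ball (hβ₀ : 0 < β) (hP : IsAliceClosed (absoluteGame β S) P)
    {b : FormalBall X} {p : List (FormalBall X)} (h : (b, p) ∈ P) :
    ∃ x, ∀ y, dist b.center y ≤ (1 - β) * b.radius → 2 * β * b.radius < dist y x →
      ∃ n ∈ P, Reach (b, p) n ∧ n.1.center = y ∧ n.1.radius = β * b.radius := by
  obtain ⟨a, ha, hr⟩ := hP.round b p h
  have hp := hP.even b p h
  rw [mem_moves_absoluteGame hp] at ha
  refine ⟨a.center, fun y hy hy' => ?_⟩
  let b' : FormalBall X := ⟨y, β * b.radius, mul_pos hβ₀ b.radius_pos⟩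
  have hb' : b'.Inside b := by
    change β * b.radius + dist b.center y ≤ b.radius
    linarith
  refine ⟨(b', a :: b :: p), hr b' ((mem_moves_absoluteGame_bob hp).2 ⟨hb', le_rfl, ?_⟩),
    reach_round a p hb', rfl, rfl⟩
  refine FormalBall.disjoint_ball ?_
  change β * b.radius + a.radius < dist y a.center
  linarith

theorem isBranching_of_isBobClosed_absoluteGame (hβ₀ : 0 < β)
    (hP : IsBobClosed (absoluteGame β S) P) : IsBranching P := by
  have hmove : ∀ m ∈ P, ∀ z, ∃ n ∈ P, Reach m n ∧ z ∉ n.1.ball := by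
    rintro ⟨b, p⟩ hm z
    have hp := hP.even b p hm
    let a : FormalBall X := ⟨z, β * b.radius, mul_pos hβ₀ b.radius_pos⟩
    obtain ⟨b', hb', h⟩ := hP.round b p hm a ((mem_moves_absoluteGame hp).2 le_rfl)
    obtain ⟨hin, -, hd⟩ := (mem_moves_absoluteGame_bob hp).1 hb'
    exact ⟨_, h, reach_round a p hin,
      fun hz => Set.disjoint_left.1 hd hz (FormalBall.center_mem_ball a)⟩
  refine ⟨⟨1 / 2, by norm_num, by norm_num, fun m hm => ?_⟩, hmove⟩
  obtain ⟨n, hn, hr, hz⟩ := hmove m hm m.1.center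
  refine ⟨n, hn, hr, ?_⟩
  have h1 : n.1.radius + dist m.1.center n.1.center ≤ m.1.radius := hr.2
  have h2 : n.1.radius < dist m.1.center n.1.center :=
    not_le.1 fun h => hz (Metric.mem_closedBall.2 h)
  linarith

/-- Pigeonhole: `x` and two points from annuli of different scales around it are pairwise more than
`4 * β * r` apart, so `w` and `z` each rule out at most one of the three. -/
theorem IsUniformlyPerfect.exists_dist_lt_dist_lt {c r : ℝ} (hX : IsUniformlyPerfect X c)
    (hc : 0 < c) (hβ₀ : 0 < β) (hβ : β < (c / 5) ^ 2) (hr₀ : 0 < r) (hr₁ : r ≤ 1) (x w z : X) :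
    ∃ y, dist x y ≤ (1 - β) * r ∧ 2 * β * r < dist y w ∧ β * r < dist y z := by
  have hc₁ : c < 1 := by
    obtain ⟨y, hy, hy'⟩ := hX x 1 one_pos le_rfl
    rw [Metric.mem_closedBall] at hy hy'
    linarith
  have hβ₁ : β < 1 / 25 := by nlinarith
  have hβr := mul_pos hβ₀ hr₀
  have hr' : 0 < (1 - β) * r := mul_pos (by linarith) hr₀
  have hr'' : (1 - β) * r ≤ 1 := by nlinarith
  obtain ⟨y₁, h₁, h₁'⟩ := hX x ((1 - β) * r) hr' hr''
  -- The outer radius is half the inner radius of the annulus of `y₁`, which separates `y₂` from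
  -- `y₁`.
  obtain ⟨y₂, h₂, h₂'⟩ := hX x (c / 2 * ((1 - β) * r)) (by positivity) (by nlinarith)
  rw [Metric.mem_closedBall'] at h₁ h₁' h₂ h₂'
  rw [not_le] at h₁' h₂'
  have hcr : c ^ 2 * (1 - β) > 8 * β := by nlinarith
  have h20 : 4 * β * r < dist x y₂ := by nlinarith
  have h2r : dist x y₂ ≤ (1 - β) * r := by nlinarith
  have h10 : 4 * β * r < dist x y₁ := by nlinarith
  have h12 : 4 * β * r < dist y₁ y₂ := by
    have : 4 * β < c / 2 * (1 - β) := by nlinarith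
    nlinarith [dist_triangle_right x y₁ y₂]
  have hx : dist x x ≤ (1 - β) * r := by rw [dist_self]; exact hr'.le
  by_contra! H
  have key : ∀ y y' : X, 4 * β * r < dist y y' → dist y w ≤ 2 * β * r → ¬ dist y' w ≤ 2 * β * r :=
    fun y y' h h1 h2 => by linarith [dist_triangle_right y y' w]
  have key' : ∀ y y' : X, 4 * β * r < dist y y' → dist y z ≤ β * r → ¬ dist y' z ≤ β * r :=
    fun y y' h h1 h2 => by linarith [dist_triangle_right y y' z]
  have d : ∀ y, dist x y ≤ (1 - β) * r → dist y w ≤ 2 * β * r ∨ dist y z ≤ β * r := fun y hy =>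
    (le_or_gt (dist y w) (2 * β * r)).imp_right (H y hy)
  rcases d x hx with h | h <;> rcases d y₁ h₁ with h' | h' <;> rcases d y₂ h2r with h'' | h''
  · exact key x y₁ h10 h h'
  · exact key x y₁ h10 h h'
  · exact key x y₂ h20 h h''
  · exact key' y₁ y₂ h12 h' h''
  · exact key y₁ y₂ h12 h' h''
  · exact key' x y₂ h20 h h''
  · exact key' x y₁ h10 h h'
  · exact key' x y₁ h10 h h'

theorem absoluteGame_isUndetermined_of_isUniformlyPerfect [CompleteSpace X] [Nonempty X] {c : ℝ}
    (hβ₀ : 0 < β) (hβ₁ : β < 1) (hc : 0 < c) (hX : IsUniformlyPerfect X c) (hS : IsBernstein S)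
    (hβ : β < (c / 5) ^ 2) : (absoluteGame β S).IsUndetermined := by
  refine isUndetermined_of_isBranching hS rfl rfl absoluteGame_inside (fun P hP => ?_)
    fun P hP => isBranching_of_isBobClosed_absoluteGame hβ₀ hP
  have key : ∀ m ∈ P ∩ {m | m.1.radius ≤ 1}, ∀ z, ∃ n ∈ P ∩ {m | m.1.radius ≤ 1},
      Reach m n ∧ n.1.radius ≤ β * m.1.radius ∧ z ∉ n.1.ball := by
    rintro ⟨b, p⟩ ⟨hm, hb⟩ z
    obtain ⟨w, hw⟩ := hP.exists_deleted_ball hβ₀ hm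
    obtain ⟨y, h1, h2, h3⟩ := hX.exists_dist_lt_dist_lt hc hβ₀ hβ b.radius_pos hb b.center w z
    obtain ⟨n, hn, hr, hy, hrad⟩ := hw y h1 h2
    refine ⟨n, ⟨hn, hr.2.radius_le.trans hb⟩, hr, hrad.le, fun hz => ?_⟩
    have hz := Metric.mem_closedBall'.1 hz
    rw [hy, hrad] at hz
    linarith
  refine ⟨⟨β, hβ₀, hβ₁, fun m hm => ?_⟩, fun m hm z => ?_⟩
  · obtain ⟨n, hn, hr, h, -⟩ := key m hm m.1.center
    exact ⟨n, hn, hr, h⟩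
  · obtain ⟨n, hn, hr, -, h⟩ := key m hm z
    exact ⟨n, hn, hr, h⟩

end Absolute

/-! ### The absolute game in Banach spaces: relative positions on a line -/

section AbsoluteBanach

variable {X : Type*} [NormedAddCommGroup X] [NormedSpace ℝ X] {β : ℝ} {S : Set X}
  {P : Set (FormalBall X × List (FormalBall X))}

/-- The relative positions of a point `z` with respect to a ball `b`, measured with a norming
functional, which guarantee that one can reach a ball that avoids `z`. -/
def escapePositions (P : Set (FormalBall X × List (FormalBall X))) (z : X) : Set ℝ :=
  {t | ∀ (f : X →L[ℝ] ℝ) (v : X), IsNormingPair f v → ∀ b p, (b, p) ∈ P →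
    f z - f b.center = t * b.radius → ∃ n ∈ P, Reach (b, p) n ∧ z ∉ n.1.ball}

/-- This symmetry is why `escapePositions` quantifies over all norming pairs. -/
theorem neg_mem_escapePositions {z : X} {t : ℝ} (ht : t ∈ escapePositions P z) :
    -t ∈ escapePositions P z := fun f v hf b p hb h =>
  ht (-f) (-v) hf.neg b p hb (by simp only [neg_apply]; linarith)

theorem IsNormingPair.notMem_ball {f : X →L[ℝ] ℝ} {v : X} (hf : IsNormingPair f v)
    {b : FormalBall X} {z : X} (h : b.radius < |f z - f b.center|) : z ∉ b.ball := fun hz =>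
  (h.trans_le (hf.abs_sub_le _ _)).not_ge (Metric.mem_closedBall.1 hz)

theorem mem_escapePositions_of_one_lt {z : X} {t : ℝ} (ht : 1 < |t|) :
    t ∈ escapePositions P z := fun f v hf b p hb h => by
  refine ⟨(b, p), hb, .refl _, hf.notMem_ball ?_⟩
  rw [h, abs_mul, abs_of_pos b.radius_pos]
  exact lt_mul_of_one_lt_left b.radius_pos ht

/-- Bob's options on a line against a strategy of Alice. -/
theorem IsAliceClosed.exists_deleted_position (hβ₀ : 0 < β)
    (hP : IsAliceClosed (absoluteGame β S) P) {f : X →L[ℝ] ℝ} {v : X} (hf : IsNormingPair f v)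
    {b : FormalBall X} {p : List (FormalBall X)} (h : (b, p) ∈ P) :
    ∃ d : ℝ, ∀ s, |s| ≤ 1 - β → 2 * β < |s - d| →
      ∃ n ∈ P, Reach (b, p) n ∧ f n.1.center = f b.center + s * b.radius ∧
        n.1.radius = β * b.radius := by
  obtain ⟨x, hx⟩ := hP.exists_deleted_ball hβ₀ h
  have hr := b.radius_pos
  refine ⟨(f x - f b.center) / b.radius, fun s hs hs' => ?_⟩
  obtain ⟨n, hn, hbn, hc, hrad⟩ := hx (b.center + (s * b.radius) • v) (by
    rw [hf.dist_add_smul, abs_mul, abs_of_pos hr]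
    exact mul_le_mul_of_nonneg_right hs hr.le) (by
    refine lt_of_lt_of_le ?_ (hf.abs_sub_le _ _)
    have h1 := mul_lt_mul_of_pos_right hs' hr
    rw [← abs_of_pos hr, ← abs_mul, abs_of_pos hr] at h1
    refine h1.trans_eq (congrArg abs ?_)
    rw [hf.apply_add_smul]
    field_simp
    ring)
  exact ⟨n, hn, hbn, by rw [hc, hf.apply_add_smul], hrad⟩

/-- Of the two extreme moves `±(1 - β)`, the one on the side opposite to the deleted position `d` is
at distance at least `1 - β > 2 * β` from `d`. Either extreme ball avoids `z` when `z` is this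
central. -/
theorem mem_escapePositions_of_abs_lt (hβ₀ : 0 < β) (hβ : β < 1 / 3)
    (hP : IsAliceClosed (absoluteGame β S) P) {z : X} {t : ℝ} (ht : |t| < 1 - 2 * β) :
    t ∈ escapePositions P z := fun f v hf b p hb h => by
  obtain ⟨d, hd⟩ := hP.exists_deleted_position hβ₀ hf hb
  obtain ⟨s, hs, hs'⟩ : ∃ s, |s| = 1 - β ∧ 2 * β < |s - d| := by
    rcases le_total 0 d with h0 | h0
    · refine ⟨-(1 - β), by rw [abs_neg, abs_of_pos (by linarith)], ?_⟩
      rw [abs_of_neg (by linarith)]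
      linarith
    · refine ⟨1 - β, abs_of_pos (by linarith), ?_⟩
      rw [abs_of_pos (by linarith)]
      linarith
  obtain ⟨n, hn, hr, hc, hrad⟩ := hd s hs.le hs'
  refine ⟨n, hn, hr, hf.notMem_ball ?_⟩
  have h1 : f z - f n.1.center = (t - s) * b.radius := by rw [hc]; linarith
  rw [h1, hrad, abs_mul, abs_of_pos b.radius_pos]
  refine mul_lt_mul_of_pos_right ?_ b.radius_pos
  linarith [abs_sub_abs_le_abs_sub s t, abs_sub_comm s t]

/-- Moving by `t - β * t'` brings `z` to relative position `t'`. If Alice forbids this, her deletion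
is too far right to forbid `-(1 - β)` as well, and that move leaves `z` outside the ball. The window
for `β * t'` has length `2 - 6 * β`, positive since `β < 1/3`. -/
theorem mem_escapePositions_of_mem (hβ₀ : 0 < β) (hβ : β < 1 / 3)
    (hP : IsAliceClosed (absoluteGame β S) P) {z : X} {t t' : ℝ} (ht : 1 - 2 * β ≤ t)
    (ht' : t' ∈ escapePositions P z) (h₁ : t - (1 - β) ≤ β * t')
    (h₂ : β * t' < t - (1 - β) + (2 - 6 * β)) : t ∈ escapePositions P z :=
  fun f v hf b p hb h => by
  obtain ⟨d, hd⟩ := hP.exists_deleted_position hβ₀ hf hb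
  rcases lt_or_ge (2 * β) (|t - β * t' - d|) with hs | hs
  · obtain ⟨n, hn, hr, hc, hrad⟩ :=
      hd (t - β * t') (abs_le.2 ⟨by linarith, by linarith⟩) hs
    obtain ⟨n', hn', hr', hz⟩ := ht' f v hf n.1 n.2 hn (by rw [hc, hrad]; linarith)
    exact ⟨n', hn', hr.trans hr', hz⟩
  · have h1 := (abs_le.1 hs).2
    obtain ⟨n, hn, hr, hc, hrad⟩ := hd (-(1 - β)) (by rw [abs_neg, abs_of_pos (by linarith)])
      (by rw [abs_of_neg (by linarith)]; linarith)
    refine ⟨n, hn, hr, hf.notMem_ball ?_⟩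
    have h1 : f z - f n.1.center = (t + (1 - β)) * b.radius := by rw [hc]; linarith
    rw [h1, hrad, abs_mul, abs_of_pos b.radius_pos, abs_of_pos (by linarith)]
    exact mul_lt_mul_of_pos_right (by linarith) b.radius_pos

/-- When Bob repeatedly moves as far as possible towards `z`, the relative position of `z` changes by
an expanding map; so the positions from which he can avoid `z` are dense. -/
theorem exists_mem_escapePositions (hβ₀ : 0 < β) (hβ : β < 1 / 3)
    (hP : IsAliceClosed (absoluteGame β S) P) (z : X) {x y : ℝ} (hxy : x < y) :
    ∃ t ∈ escapePositions P z, x < t ∧ t < y := by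
  -- An interval longer than `2` sticks out of `[-1, 1]`. A shorter one either meets the central
  -- region or, up to sign, is stretched by the factor `1 / β` under `t ↦ (t - (1 - β)) / β`.
  have key : ∀ (n : ℕ) (x y : ℝ), 2 * β ^ n < y - x →
      ∃ t ∈ escapePositions P z, x < t ∧ t < y := by
    intro n
    induction n with
    | zero =>
      intro x y h
      rcases lt_or_ge 1 y with hy | hy
      · obtain ⟨t, ht, ht'⟩ := exists_between (max_lt (by linarith) hy : max x 1 < y)
        obtain ⟨h1, h2⟩ := max_lt_iff.1 ht
        exact ⟨t, mem_escapePositions_of_one_lt (h2.trans_le (le_abs_self t)), h1, ht'⟩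
      · obtain ⟨t, ht, ht'⟩ :=
          exists_between (lt_min (by linarith) (by linarith) : x < min y (-1))
        obtain ⟨h1, h2⟩ := lt_min_iff.1 ht'
        exact ⟨t, mem_escapePositions_of_one_lt (by linarith [neg_le_abs t]), ht, h1⟩
    | succ n ih =>
      intro x y h
      have hpos : ∀ x y : ℝ, 2 * β ^ (n + 1) < y - x → 1 - 2 * β ≤ x →
          ∃ t ∈ escapePositions P z, x < t ∧ t < y := fun x y h hx => by
        obtain ⟨t', ht', h1, h2⟩ := ih ((x - (1 - β)) / β) ((y - (1 - β)) / β) (by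
          rw [← sub_div, lt_div_iff₀ hβ₀]
          rw [pow_succ] at h
          linarith)
        rw [div_lt_iff₀ hβ₀] at h1
        rw [lt_div_iff₀ hβ₀] at h2
        exact ⟨1 - β + β * t', mem_escapePositions_of_mem hβ₀ hβ hP (by linarith) ht'
          (by linarith) (by linarith), by linarith, by linarith⟩
      have hxy : x < y := by
        have := pow_pos hβ₀ (n + 1)
        linarith
      rcases le_or_gt (1 - 2 * β) x with hx | hx
      · exact hpos x y h hx
      rcases le_or_gt y (-(1 - 2 * β)) with hy | hy
      · obtain ⟨t, ht, h1, h2⟩ := hpos (-y) (-x) (by linarith) (by linarith)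
        exact ⟨-t, neg_mem_escapePositions ht, by linarith, by linarith⟩
      obtain ⟨t, ht, ht'⟩ := exists_between (max_lt (lt_min hxy hx) (lt_min hy (by linarith)) :
        max x (-(1 - 2 * β)) < min y (1 - 2 * β))
      rw [max_lt_iff] at ht
      rw [lt_min_iff] at ht'
      exact ⟨t, mem_escapePositions_of_abs_lt hβ₀ hβ hP (abs_lt.2 ⟨ht.2, ht'.2⟩), ht.1, ht'.1⟩
  obtain ⟨n, hn⟩ := exists_pow_lt_of_lt_one (half_pos (sub_pos.2 hxy)) (by linarith : β < 1)
  exact key n x y (by linarith)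

theorem mem_escapePositions (hβ₀ : 0 < β) (hβ : β < 1 / 3)
    (hP : IsAliceClosed (absoluteGame β S) P) (z : X) (t : ℝ) : t ∈ escapePositions P z := by
  have hpos : ∀ t, 1 - 2 * β ≤ t → t ∈ escapePositions P z := fun t ht => by
    -- Density supplies a `t'` in the whole window allowed by `mem_escapePositions_of_mem`, so no
    -- exceptional `t` remains.
    obtain ⟨t', ht', h1, h2⟩ := exists_mem_escapePositions hβ₀ hβ hP z
      (div_lt_div_of_pos_right (by linarith : t - (1 - β) < t - (1 - β) + (2 - 6 * β)) hβ₀)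
    rw [div_lt_iff₀ hβ₀] at h1
    rw [lt_div_iff₀ hβ₀] at h2
    exact mem_escapePositions_of_mem hβ₀ hβ hP ht ht' (by linarith) (by linarith)
  rcases lt_or_ge |t| (1 - 2 * β) with ht | ht
  · exact mem_escapePositions_of_abs_lt hβ₀ hβ hP ht
  rcases le_abs.1 ht with ht | ht
  · exact hpos t ht
  · exact neg_neg t ▸ neg_mem_escapePositions (hpos (-t) ht)

theorem absoluteGame_isUndetermined_of_banach [CompleteSpace X] [Nontrivial X] (hβ₀ : 0 < β)
    (hβ : β < 1 / 3) (hS : IsBernstein S) : (absoluteGame β S).IsUndetermined := by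
  refine isUndetermined_of_isBranching hS rfl rfl absoluteGame_inside
    (fun P hP => .inter_radius_le ⟨⟨β, hβ₀, by linarith, ?_⟩, ?_⟩ 1)
    fun P hP => isBranching_of_isBobClosed_absoluteGame hβ₀ hP
  · rintro ⟨b, p⟩ hm
    obtain ⟨f, v, hf⟩ := exists_isNormingPair (X := X)
    obtain ⟨d, hd⟩ := hP.exists_deleted_position hβ₀ hf hm
    rcases le_total 0 d with h0 | h0
    · obtain ⟨n, hn, hr, -, h⟩ := hd (-(1 - β)) (by rw [abs_neg, abs_of_pos (by linarith)])
        (by rw [abs_of_neg (by linarith)]; linarith)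
      exact ⟨n, hn, hr, h.le⟩
    · obtain ⟨n, hn, hr, -, h⟩ := hd (1 - β) (abs_of_pos (by linarith)).le
        (by rw [abs_of_pos (by linarith)]; linarith)
      exact ⟨n, hn, hr, h.le⟩
  · rintro ⟨b, p⟩ hm z
    obtain ⟨f, v, hf⟩ := exists_isNormingPair (X := X)
    exact mem_escapePositions hβ₀ hβ hP z ((f z - f b.center) / b.radius) f v hf b p hm
      (div_mul_cancel₀ _ b.radius_pos.ne').symm

end AbsoluteBanach

theorem theorem1p4 (α β : ℝ) (hα₀ : 0 < α) (hα₁ : α < 1) (hβ₀ : 0 < β) (hβ₁ : β < 1) :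
    -- (i)
    (∀ (X : Type*) [MetricSpace X] [CompleteSpace X] [Nonempty X] (c : ℝ) (S : Set X),
      0 < c → IsUniformlyPerfect X c → IsBernstein S →
      α < c / (1 + 2 * c) → β < c / (1 + 2 * c) →
      (schmidtGame α β S).IsUndetermined ∧ (strongGame α β S).IsUndetermined) ∧
    -- (ii)
    (∀ (X : Type*) [NormedAddCommGroup X] [NormedSpace ℝ X] [CompleteSpace X] [Nontrivial X]
      (S : Set X), IsBernstein S →
      2 * max α β < 1 + α * β →
      (schmidtGame α β S).IsUndetermined ∧ (strongGame α β S).IsUndetermined) ∧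
    -- (iii)
    (∀ (X : Type*) [MetricSpace X] [CompleteSpace X] [Nonempty X] (c : ℝ) (S : Set X),
      0 < c → IsUniformlyPerfect X c → IsBernstein S →
      β < (c / 5) ^ 2 →
      (absoluteGame β S).IsUndetermined) ∧
    -- (iv)
    (∀ (X : Type*) [NormedAddCommGroup X] [NormedSpace ℝ X] [CompleteSpace X] [Nontrivial X]
      (S : Set X), IsBernstein S →
      β < 1 / 3 →
      (absoluteGame β S).IsUndetermined) := by
  refine ⟨?_, ?_, ?_, ?_⟩
  · intro X _ _ _ c S hc hX hS hα hβ
    exact ⟨isNestedGame_schmidtGame.isUndetermined_of_isUniformlyPerfect rfl hα₀ hα₁ hβ₀ hβ₁ hc hX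
      hS hα hβ, isNestedGame_strongGame.isUndetermined_of_isUniformlyPerfect rfl hα₀ hα₁ hβ₀ hβ₁ hc
      hX hS hα hβ⟩
  · intro X _ _ _ _ S hS h
    exact ⟨isNestedGame_schmidtGame.isUndetermined_of_banach rfl hα₀ hα₁ hβ₀ hβ₁ hS h,
      isNestedGame_strongGame.isUndetermined_of_banach rfl hα₀ hα₁ hβ₀ hβ₁ hS h⟩
  · intro X _ _ _ c S hc hX hS hβ
    exact absoluteGame_isUndetermined_of_isUniformlyPerfect hβ₀ hβ₁ hc hX hS hβ
  · intro X _ _ _ _ S hS hβ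
    exact absoluteGame_isUndetermined_of_banach hβ₀ hβ hS
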